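/- Let $\Pi$ be a set, let $C \subset \mathbb{R}^d$ be a nonempty set contained in a Euclidean ball of radius $R$, and let $\mathcal{F} = \{ f_\rho : \Pi \to [0,1] \mid \rho \in C \}$. Let $S = (x_1, \dots, x_T)$, $T \ge 1$, be points of $\Pi$, and let $u_{x_i} : C \to [0,1]$ be the dual functions $u_{x_i}(\rho) = f_\rho(x_i)$. Let $L \ge 0$, $w > 0$ and $k \in \{0, 1, 2, \dots\}$. Suppose that $u_{x_1}, \dots, u_{x_T}$ are piecewise $L$-Lipschitz and $(w,k)$-dispersed, that is, there are partitions $\mathcal{P}_1, \dots, \mathcal{P}_T$ of $C$ such that $u_{x_i}$ is $L$-Lipschitz (for the Euclidean distance) on each set of $\mathcal{P}_i$, and every closed ball of radius $w$ in $\mathbb{R}^d$ is split by at most $k$ of the partitions $\mathcal{P}_1, \dots, \mathcal{P}_T$, where a partition splits a set if the set intersects at least two of its parts. The empirical Rademacher complexity of $\mathcal{F}$ on $S$ is $$\hat R(\mathcal{F}, S) = \mathbb{E}_{\sigma}\Bigl[ \sup_{f \in \mathcal{F}} \frac{1}{T} \sum_{i=1}^T \sigma_i f(x_i) \Bigr],$$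 with $\sigma_1, \dots, \sigma_T$ independent and uniform on $\{-1, 1\}$. The pseudo-dimension $\mathrm{Pdim}(\mathcal{F}) \in \{0, 1, 2, \dots\} \cup \{\infty\}$ is the supremum of the cardinalities of the finite sets $A \subset \Pi$ for which there are thresholds $(s_x)_{x \in A}$ in $\mathbb{R}$ such that for every $E \subseteq A$ some $f \in \mathcal{F}$ satisfies $f(x) \ge s_x$ for all $x \in E$ and $f(x) < s_x$ for all $x \in A \setminus E$. Then, as long as $R/w$ is bounded away from $1$, $$\hat R(\mathcal{F}, S) \le O\left( \min\left\{ \sqrt{\frac{d}{T} \log \frac{R}{w}} + L w + \frac{k}{T},\ \sqrt{\frac{\mathrm{Pdim}(\mathcal{F})}{T}} \right\} \right).$$ Precisely: for every $c > 1$ there is a constant $K > 0$, depending only on $c$, such that, whenever the above holds and $R \ge c\,w$, the left side is at most $K$ times the minimum (if $\mathrm{Pdim}(\mathcal{F}) = \infty$, the minimum is its first term). -/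

import Mathlib

open scoped NNReal ENNReal

universe u

/-- `P` is a partition of the set `C`: nonempty, pairwise disjoint sets with union `C`. -/
structure IsPartitionOf {E : Type*} (C : Set E) (P : Set (Set E)) : Prop where
  nonempty_of_mem : ∀ p ∈ P, p.Nonempty
  pairwiseDisjoint : P.PairwiseDisjoint id
  sUnion_eq : ⋃₀ P = C

/-- The partition `P` splits the set `A`: `A` meets at least two sets of `P`. -/
def Splits {E : Type*} (P : Set (Set E)) (A : Set E) : Prop :=
  ∃ p ∈ P, ∃ q ∈ P, p ≠ q ∧ (A ∩ p).Nonempty ∧ (A ∩ q).Nonempty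

/-- `g` is `L`-Lipschitz on every piece of the partition `P`. -/
def PiecewiseLipschitzOver {E : Type*} [PseudoEMetricSpace E]
    (L : ℝ≥0) (P : Set (Set E)) (g : E → ℝ) : Prop :=
  ∀ p ∈ P, LipschitzOnWith L g p

/-- Every closed ball of radius `w` is split by at most `k` of the partitions `P i`
(counted with multiplicity in the index). -/
def PartitionsDispersed {E : Type*} [PseudoMetricSpace E] {T : ℕ}
    (w : ℝ) (k : ℕ) (P : Fin T → Set (Set E)) : Prop :=
  ∀ c : E, {i : Fin T | Splits (P i) (Metric.closedBall c w)}.ncard ≤ k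

/-- The functions `g i` on `C` are piecewise `L`-Lipschitz and `(w, k)`-dispersed: each `g i` is
piecewise `L`-Lipschitz over a partition `P i` of `C`, and every ball of radius `w` is split by
at most `k` of these partitions. -/
def PiecewiseLipschitzDispersed {E : Type*} [PseudoMetricSpace E] {T : ℕ}
    (C : Set E) (L : ℝ≥0) (w : ℝ) (k : ℕ) (g : Fin T → E → ℝ) : Prop :=
  ∃ P : Fin T → Set (Set E),
    (∀ i, IsPartitionOf C (P i)) ∧
    (∀ i, PiecewiseLipschitzOver L (P i) (g i)) ∧
    PartitionsDispersed w k P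

/-- The empirical Rademacher complexity of the function class `F` on the sample `x`,
`𝔼_σ [sup_{f ∈ F} (1/T) ∑ i, σ i * f (x i)]`, with `σ` uniform on `{-1, 1}^T`
(the type `ℤˣ` is `{1, -1}`). -/
noncomputable def empiricalRademacher {X : Type*} {T : ℕ} (F : Set (X → ℝ)) (x : Fin T → X) : ℝ :=
  (1 / (2 : ℝ) ^ T) * ∑ σ : Fin T → ℤˣ,
    sSup ((fun f : X → ℝ => (1 / (T : ℝ)) * ∑ i, (((σ i : ℤˣ) : ℤ) : ℝ) * f (x i)) '' F)

/-- `F` P-shatters the finite set `S`. -/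
def PShatters {X : Type*} (F : Set (X → ℝ)) (S : Finset X) : Prop :=
  ∃ s : X → ℝ, ∀ E ⊆ S, ∃ f ∈ F, ∀ x ∈ S, (x ∈ E → s x ≤ f x) ∧ (x ∉ E → f x < s x)

/-- The pseudo-dimension of `F`: the supremum (possibly `⊤`) of the cardinalities of the finite
sets that `F` P-shatters. -/
noncomputable def pseudoDim {X : Type*} (F : Set (X → ℝ)) : ℕ∞ :=
  ⨆ (S : Finset X) (_ : PShatters F S), (S.card : ℕ∞)

/-! Both bounds replace the supremum by maxima over finite nets, whose sign averages Massart's lemma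
`signAverage_sup_le` controls.

Dispersed bound: by volume, a `w`-net of `C` has at most `(3R/w)^d` points. Moving `ρ` to a net
point within `w` changes the `T` values by at most `TLw + k` in total: at most `k` of them can cross
a boundary between pieces, each changing by at most 1.

Pseudo-dimension bound: a single net would cost a logarithm, so one chains over empirical `L²` nets
at scales `2^(-j)`. Their log-sizes are at most `9D(j+1)`, independent of `T` (`exists_l2_net`), and
the increments form a convergent series. The sizes come from `log_card_le_of_separated`: `N`
functions pairwise far apart disagree on many pairs (sample point, threshold), so some `O(log N /
ε)` such pairs tell all of them apart. Sauer–Shelah then bounds `N` in terms of `D` and `log N`, and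
the inequality solves for `log N`. -/

/-- The signed sum `∑ i, σ i * v i`. -/
def signedSum {T : ℕ} (σ : Fin T → ℤˣ) (v : Fin T → ℝ) : ℝ :=
  ∑ i, (((σ i : ℤˣ) : ℤ) : ℝ) * v i

/-- The average of `g` over uniformly random signs. -/
noncomputable def signAverage {T : ℕ} (g : (Fin T → ℤˣ) → ℝ) : ℝ :=
  (1 / (2 : ℝ) ^ T) * ∑ σ, g σ

/-! ### Averages over random signs and Massart's lemma -/

section SignAverage

variable {T : ℕ}

lemma signAverage_mono {g h : (Fin T → ℤˣ) → ℝ} (H : ∀ σ, g σ ≤ h σ) :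
    signAverage g ≤ signAverage h := by
  unfold signAverage
  gcongr with σ
  exact H σ

lemma signAverage_add (g h : (Fin T → ℤˣ) → ℝ) :
    signAverage (fun σ => g σ + h σ) = signAverage g + signAverage h := by
  simp only [signAverage, Finset.sum_add_distrib, mul_add]

lemma signAverage_const_mul (a : ℝ) (g : (Fin T → ℤˣ) → ℝ) :
    signAverage (fun σ => a * g σ) = a * signAverage g := by
  simp only [signAverage, ← Finset.mul_sum]
  ring

lemma signAverage_const (a : ℝ) : signAverage (fun _ : Fin T → ℤˣ => a) = a := by
  simp [signAverage]

lemma signAverage_sum {ι : Type*} (s : Finset ι) (g : ι → (Fin T → ℤˣ) → ℝ) :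
    signAverage (fun σ => ∑ a ∈ s, g a σ) = ∑ a ∈ s, signAverage (g a) := by
  simp only [signAverage, ← Finset.mul_sum]
  rw [Finset.sum_comm]

lemma exp_signAverage_le (g : (Fin T → ℤˣ) → ℝ) :
    Real.exp (signAverage g) ≤ signAverage (fun σ => Real.exp (g σ)) := by
  have h := convexOn_exp.map_sum_le (t := Finset.univ) (w := fun _ : Fin T → ℤˣ => 1 / (2 : ℝ) ^ T)
    (p := g) (fun _ _ => by positivity) (by simp) (by simp)
  simpa [signAverage, Finset.mul_sum] using h

/-- Independence of the signs: a product of two-point averages expands into the average over all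
sign vectors. -/
lemma signAverage_exp_signedSum (v : Fin T → ℝ) :
    signAverage (fun σ => Real.exp (signedSum σ v)) = ∏ i, Real.cosh (v i) := by
  have h : ∀ i, Real.cosh (v i) = (1 / 2) * ∑ e : ℤˣ, Real.exp (((e : ℤ) : ℝ) * v i) := by
    intro i
    rw [Real.cosh_eq]
    simp
    ring
  simp only [h, Finset.prod_mul_distrib, signAverage, signedSum, Real.exp_sum,
    Fintype.prod_sum]
  simp

lemma signAverage_exp_signedSum_le (v : Fin T → ℝ) :
    signAverage (fun σ => Real.exp (signedSum σ v)) ≤ Real.exp ((∑ i, v i ^ 2) / 2) := by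
  rw [signAverage_exp_signedSum, Finset.sum_div, Real.exp_sum]
  exact Finset.prod_le_prod (fun i _ => (Real.cosh_pos _).le) fun i _ => Real.cosh_le_exp_half_sq _

lemma signedSum_const_mul (σ : Fin T → ℤˣ) (a : ℝ) (v : Fin T → ℝ) :
    signedSum σ (fun i => a * v i) = a * signedSum σ v := by
  simp only [signedSum, Finset.mul_sum]
  exact Finset.sum_congr rfl fun i _ => by ring

lemma signedSum_sub (σ : Fin T → ℤˣ) (v w : Fin T → ℝ) :
    signedSum σ (fun i => v i - w i) = signedSum σ v - signedSum σ w := by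
  simp only [signedSum, ← Finset.sum_sub_distrib]
  exact Finset.sum_congr rfl fun i _ => by ring

lemma abs_sign (e : ℤˣ) : |((e : ℤ) : ℝ)| = 1 := by
  rcases Int.units_eq_one_or e with rfl | rfl <;> simp

lemma signedSum_le_sum_abs (σ : Fin T → ℤˣ) (v : Fin T → ℝ) :
    signedSum σ v ≤ ∑ i, |v i| := by
  refine Finset.sum_le_sum fun i _ => (le_abs_self _).trans ?_
  rw [abs_mul, abs_sign, one_mul]

lemma signAverage_signedSum (v : Fin T → ℝ) : signAverage (fun σ => signedSum σ v) = 0 := by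
  have h : ∑ σ : Fin T → ℤˣ, signedSum σ v = ∑ σ : Fin T → ℤˣ, -signedSum σ v := by
    rw [← Equiv.sum_comp (Equiv.neg (Fin T → ℤˣ))]
    refine Finset.sum_congr rfl fun σ _ => ?_
    simp [signedSum]
  rw [Finset.sum_neg_distrib] at h
  have : ∑ σ : Fin T → ℤˣ, signedSum σ v = 0 := by linarith
  simp [signAverage, this]

/-- Massart's finite class lemma. -/
lemma signAverage_sup_le {ι : Type*} (s : Finset ι) (hs : s.Nonempty) (v : ι → Fin T → ℝ)
    {r B : ℝ} (hr : 0 < r) (hB : 0 < B) (hv : ∀ a ∈ s, ∑ i, v a i ^ 2 ≤ r ^ 2)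
    (hcard : Real.log s.card ≤ B) :
    signAverage (fun σ => s.sup' hs fun a => signedSum σ (v a)) ≤ r * Real.sqrt (2 * B) := by
  set q := Real.sqrt (2 * B) with hq
  have hq0 : 0 < q := by positivity
  have hq2 : q ^ 2 = 2 * B := Real.sq_sqrt (by positivity)
  -- The minimiser of `B / t + t r² / 2`, the bound given by the exponential moment method.
  set t := q / r with ht
  have ht0 : 0 < t := by positivity
  have hcard0 : (0 : ℝ) < s.card := by exact_mod_cast hs.card_pos
  have key : Real.exp (t * signAverage (fun σ => s.sup' hs fun a => signedSum σ (v a)))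
      ≤ Real.exp (B + t ^ 2 * r ^ 2 / 2) := by
    rw [← signAverage_const_mul]
    refine (exp_signAverage_le _).trans ?_
    calc signAverage (fun σ => Real.exp (t * s.sup' hs fun a => signedSum σ (v a)))
        ≤ signAverage (fun σ => ∑ a ∈ s, Real.exp (signedSum σ fun i => t * v a i)) := by
          refine signAverage_mono fun σ => ?_
          obtain ⟨a, ha, hmax⟩ := s.exists_mem_eq_sup' hs fun a => signedSum σ (v a)
          rw [hmax, ← signedSum_const_mul]
          exact Finset.single_le_sum
            (f := fun a => Real.exp (signedSum σ fun i => t * v a i))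
            (fun _ _ => (Real.exp_pos _).le) ha
      _ ≤ ∑ _a ∈ s, Real.exp (t ^ 2 * r ^ 2 / 2) := by
          rw [signAverage_sum]
          refine Finset.sum_le_sum fun a ha => (signAverage_exp_signedSum_le _).trans ?_
          simp only [mul_pow, ← Finset.mul_sum]
          gcongr
          exact hv a ha
      _ ≤ Real.exp (B + t ^ 2 * r ^ 2 / 2) := by
          rw [Finset.sum_const, nsmul_eq_mul, Real.exp_add]
          gcongr
          exact (Real.log_le_iff_le_exp hcard0).1 hcard
  have h1 := Real.exp_le_exp.1 key
  have h2 : t ^ 2 * r ^ 2 = 2 * B := by rw [ht, div_pow, hq2]; field_simp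
  have h3 : t * (r * q) = 2 * B := by rw [ht, ← hq2]; field_simp
  have h4 : t * signAverage (fun σ => s.sup' hs fun a => signedSum σ (v a)) ≤ t * (r * q) := by
    rw [h3]; linarith
  exact le_of_mul_le_mul_left h4 ht0

end SignAverage

/-- A bound for the empirical Rademacher complexity from a pointwise bound on the suprema. -/
lemma empiricalRademacher_le_signAverage {X : Type*} {T : ℕ} {F : Set (X → ℝ)} (hF : F.Nonempty)
    (x : Fin T → X) (g : (Fin T → ℤˣ) → ℝ)
    (h : ∀ σ, ∀ f ∈ F, signedSum σ (fun i => f (x i)) ≤ g σ) :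
    empiricalRademacher F x ≤ (1 / (T : ℝ)) * signAverage g := by
  rw [← signAverage_const_mul]
  refine signAverage_mono fun σ => csSup_le (hF.image _) ?_
  rintro _ ⟨f, hf, rfl⟩
  exact mul_le_mul_of_nonneg_left (h σ f hf) (by positivity)

lemma empiricalRademacher_nonpos_of_subsingleton {X : Type*} {T : ℕ} {F : Set (X → ℝ)}
    (hF : F.Nonempty) (hs : F.Subsingleton) (x : Fin T → X) : empiricalRademacher F x ≤ 0 := by
  obtain ⟨f, hf⟩ := hF
  refine (empiricalRademacher_le_signAverage ⟨f, hf⟩ x (fun σ => signedSum σ fun i => f (x i))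
    fun σ g hg => by rw [hs hg hf]).trans ?_
  rw [signAverage_signedSum, mul_zero]

/-! ### Nets and the dispersed bound -/

/-- A maximal `r`-separated subset is a net. -/
lemma exists_net {α : Type*} (r : α → α → Prop) (hr : ∀ a b, r a b → r b a) (A : Set α) (N : ℕ)
    (hN : ∀ S : Finset α, (S : Set α) ⊆ A → (S : Set α).Pairwise r → S.card ≤ N) :
    ∃ S : Finset α, (S : Set α) ⊆ A ∧ (S : Set α).Pairwise r ∧
      ∀ a ∈ A, ∃ b ∈ S, a = b ∨ ¬ r a b := by
  classical
  set I : Set ℕ := {n | ∃ S : Finset α, (S : Set α) ⊆ A ∧ (S : Set α).Pairwise r ∧ S.card = n}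
  have hb : BddAbove I := ⟨N, by rintro _ ⟨S, h1, h2, rfl⟩; exact hN S h1 h2⟩
  obtain ⟨S, h1, h2, h3⟩ : sSup I ∈ I := Nat.sSup_mem ⟨0, ∅, by simp⟩ hb
  refine ⟨S, h1, h2, fun a ha => ?_⟩
  by_contra! hcon
  have haS : a ∉ S := fun h => (hcon a h).1 rfl
  have hmem : (insert a S).card ∈ I := by
    refine ⟨insert a S, ?_, ?_, rfl⟩
    · rw [Finset.coe_insert]
      exact Set.insert_subset ha h1
    · rw [Finset.coe_insert]
      refine h2.insert fun b hb' _ => ?_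
      exact ⟨(hcon b hb').2, hr _ _ (hcon b hb').2⟩
  have := le_csSup hb hmem
  rw [Finset.card_insert_of_notMem haS, ← h3] at this
  omega

open MeasureTheory Metric in
open scoped Function in
/-- A `w`-separated subset of a ball of radius `R` has at most `(1 + 2 R / w) ^ dim` points. -/
lemma card_le_of_separated_of_subset_closedBall {E : Type*} [NormedAddCommGroup E]
    [NormedSpace ℝ E] [FiniteDimensional ℝ E] (S : Finset E) (x₀ : E) {R w : ℝ} (hR : 0 ≤ R)
    (hw : 0 < w) (hS : (S : Set E) ⊆ closedBall x₀ R)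
    (hsep : (S : Set E).Pairwise fun a b => w < dist a b) :
    (S.card : ℝ) ≤ (1 + 2 * R / w) ^ Module.finrank ℝ E := by
  borelize E
  let μ : Measure E := Measure.addHaar
  set n := Module.finrank ℝ E
  have hw2 : 0 < w / 2 := by positivity
  have hρ : 0 < R + w / 2 := by positivity
  -- Volume comparison: disjoint balls of radius `w / 2` packed into one of radius `R + w / 2`.
  have D : Set.Pairwise (S : Set E) (Disjoint on fun c => ball (c : E) (w / 2)) := by
    intro a ha b hb hab
    apply ball_disjoint_ball
    have := hsep ha hb hab
    linarith
  have hsub : (⋃ a ∈ S, ball (a : E) (w / 2)) ⊆ ball x₀ (R + w / 2) := by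
    refine Set.iUnion₂_subset fun a ha => ball_subset_ball' ?_
    have := mem_closedBall.1 (hS ha)
    linarith
  have I : (S.card : ℝ≥0∞) * ENNReal.ofReal ((w / 2) ^ n) * μ (ball 0 1) ≤
      ENNReal.ofReal ((R + w / 2) ^ n) * μ (ball 0 1) :=
    calc
      _ = μ (⋃ a ∈ S, ball (a : E) (w / 2)) := by
        rw [measure_biUnion_finset D fun c _ => measurableSet_ball]
        simp only [μ.addHaar_ball_of_pos _ hw2, Finset.sum_const, nsmul_eq_mul, mul_assoc, n]
      _ ≤ μ (ball x₀ (R + w / 2)) := measure_mono hsub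
      _ = _ := μ.addHaar_ball_of_pos _ hρ
  have J : (S.card : ℝ≥0∞) * ENNReal.ofReal ((w / 2) ^ n) ≤ ENNReal.ofReal ((R + w / 2) ^ n) :=
    (ENNReal.mul_le_mul_iff_left (measure_ball_pos _ _ zero_lt_one).ne' measure_ball_lt_top.ne).1 I
  have K := ENNReal.toReal_le_of_le_ofReal (pow_nonneg hρ.le _) J
  rw [ENNReal.toReal_mul, ENNReal.toReal_natCast, ENNReal.toReal_ofReal (by positivity)] at K
  have h : (1 + 2 * R / w) ^ n = (R + w / 2) ^ n / (w / 2) ^ n := by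
    rw [← div_pow]
    congr 1
    field_simp
    ring
  rwa [h, le_div_iff₀ (by positivity)]

/-- Dispersed piecewise Lipschitz functions change little, on average over the sample, between two
points at distance at most `w`. -/
lemma PiecewiseLipschitzDispersed.sum_abs_sub_le {E : Type*} [PseudoMetricSpace E] {T : ℕ}
    {C : Set E} {L : ℝ≥0} {w : ℝ} {k : ℕ} {g : Fin T → E → ℝ}
    (h : PiecewiseLipschitzDispersed C L w k g) (hg : ∀ i, ∀ a ∈ C, g i a ∈ Set.Icc (0 : ℝ) 1)
    (hw : 0 ≤ w) {a b : E} (ha : a ∈ C) (hb : b ∈ C) (hab : dist a b ≤ w) :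
    ∑ i, |g i a - g i b| ≤ T * (L * w) + k := by
  classical
  obtain ⟨P, hP, hL, hk⟩ := h
  have hi : ∀ i, |g i a - g i b| ≤ L * w + if Splits (P i) (Metric.closedBall b w) then 1 else 0 := by
    intro i
    have hLw : 0 ≤ (L : ℝ) * w := by positivity
    split_ifs with hs
    · have h1 := hg i a ha
      have h2 := hg i b hb
      have : |g i a - g i b| ≤ 1 := abs_le.2 ⟨by linarith [h1.1, h2.2], by linarith [h1.2, h2.1]⟩
      linarith
    · rw [← (hP i).sUnion_eq] at ha hb
      obtain ⟨p, hp, hap⟩ := ha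
      obtain ⟨q, hq, hbq⟩ := hb
      have hpq : p = q := by
        by_contra hne
        exact hs ⟨p, hp, q, hq, hne, ⟨a, hab, hap⟩, ⟨b, Metric.mem_closedBall_self hw, hbq⟩⟩
      subst hpq
      have := (hL i p hp).dist_le_mul a hap b hbq
      rw [Real.dist_eq] at this
      rw [add_zero]
      exact this.trans (by gcongr)
  refine (Finset.sum_le_sum fun i _ => hi i).trans ?_
  rw [Finset.sum_add_distrib, Finset.sum_const, Finset.sum_boole]
  have hkb := hk b
  rw [Set.ncard_eq_toFinset_card', Set.toFinset_ofPred] at hkb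
  have : ((Finset.univ.filter fun i => Splits (P i) (Metric.closedBall b w)).card : ℝ) ≤ k := by
    exact_mod_cast hkb
  simpa using this

/-- The bound for dispersed classes. -/
lemma empiricalRademacher_le_of_dispersed {c : ℝ} (hc : 1 < c) {X : Type*} {d T : ℕ}
    {C : Set (EuclideanSpace ℝ (Fin d))} {f : EuclideanSpace ℝ (Fin d) → X → ℝ} {x : Fin T → X}
    {ρ₀ : EuclideanSpace ℝ (Fin d)} {R w : ℝ} {L : ℝ≥0} {k : ℕ} (hT : 0 < T) (hC : C.Nonempty)
    (hf : ∀ ρ ∈ C, ∀ y : X, f ρ y ∈ Set.Icc (0 : ℝ) 1) (hCR : C ⊆ Metric.closedBall ρ₀ R)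
    (hw : 0 < w) (hR : c * w ≤ R)
    (hdisp : PiecewiseLipschitzDispersed C L w k (fun i ρ => f ρ (x i))) :
    empiricalRademacher (f '' C) x ≤ (Real.sqrt (2 * (1 + Real.log 3 / Real.log c)) + 1) *
      (Real.sqrt ((d : ℝ) / T * Real.log (R / w)) + (L : ℝ) * w + (k : ℝ) / T) := by
  have hT' : (0 : ℝ) < T := by exact_mod_cast hT
  have hlogc : 0 < Real.log c := Real.log_pos hc
  have hlog3 : 0 < Real.log 3 := Real.log_pos (by norm_num)
  have hcR : c ≤ R / w := (le_div_iff₀ hw).2 hR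
  have hℓ : Real.log c ≤ Real.log (R / w) := Real.log_le_log (by linarith) hcR
  have hR0 : 0 < R := lt_of_lt_of_le (by positivity) hR
  set ℓ := Real.log (R / w) with hℓdef
  have hℓ0 : 0 < ℓ := hlogc.trans_le hℓ
  set a := 1 + Real.log 3 / Real.log c with ha
  have ha0 : 0 < a := by positivity
  -- Massart's lemma needs `B > 0`, which fails for `d = 0`; there the parameter space is a point.
  rcases Nat.eq_zero_or_pos d with rfl | hd
  · refine (empiricalRademacher_nonpos_of_subsingleton (hC.image f)
      (Set.Subsingleton.image Set.subsingleton_of_subsingleton f) x).trans ?_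
    positivity
  have hd' : (0 : ℝ) < d := by exact_mod_cast hd
  have hlog : Real.log (1 + 2 * R / w) ≤ a * ℓ := by
    have h1 : 1 + 2 * R / w ≤ 3 * (R / w) := by
      have : 2 * R / w = 2 * (R / w) := by ring
      linarith
    -- Here `R / w` being bounded away from 1 is used: the additive `log 3` is absorbed into a
    -- multiple of `log (R / w)`.
    have h2 : Real.log 3 ≤ Real.log 3 / Real.log c * ℓ := by
      rw [div_mul_eq_mul_div, le_div_iff₀ hlogc]
      gcongr
    calc Real.log (1 + 2 * R / w) ≤ Real.log (3 * (R / w)) := Real.log_le_log (by positivity) h1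
      _ = Real.log 3 + ℓ := Real.log_mul (by norm_num) (by positivity)
      _ ≤ a * ℓ := by rw [ha]; linarith
  -- The net lies inside `C`, the only place where the dual functions are controlled.
  obtain ⟨S, hSC, hSsep, hSnet⟩ := exists_net (fun p q => w < dist p q)
    (fun p q h => by rwa [dist_comm]) C ⌊(1 + 2 * R / w) ^ d⌋₊ fun S h1 h2 => Nat.le_floor (by
      simpa using card_le_of_separated_of_subset_closedBall S ρ₀ hR0.le hw (h1.trans hCR) h2)
  have hSne : S.Nonempty := by
    obtain ⟨p, hp⟩ := hC
    obtain ⟨q, hq, -⟩ := hSnet p hp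
    exact ⟨q, hq⟩
  have hcard : Real.log S.card ≤ d * (a * ℓ) := by
    have h1 := card_le_of_separated_of_subset_closedBall S ρ₀ hR0.le hw (hSC.trans hCR) hSsep
    rw [finrank_euclideanSpace_fin] at h1
    have h2 : (0 : ℝ) < S.card := by exact_mod_cast hSne.card_pos
    calc Real.log S.card ≤ Real.log ((1 + 2 * R / w) ^ d) := Real.log_le_log h2 h1
      _ = d * Real.log (1 + 2 * R / w) := Real.log_pow _ _
      _ ≤ d * (a * ℓ) := by gcongr
  have hmassart := signAverage_sup_le S hSne (fun ρ i => f ρ (x i)) (r := Real.sqrt T)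
    (B := d * (a * ℓ)) (by positivity) (by positivity) (by
      intro ρ hρ
      rw [Real.sq_sqrt hT'.le]
      calc ∑ i, f ρ (x i) ^ 2 ≤ ∑ _i : Fin T, (1 : ℝ) := by
            refine Finset.sum_le_sum fun i _ => ?_
            have := hf ρ (hSC hρ) (x i)
            exact pow_le_one₀ this.1 this.2
        _ = T := by simp) hcard
  have hmain := empiricalRademacher_le_signAverage (hC.image f) x
    (fun σ => (S.sup' hSne fun ρ => signedSum σ fun i => f ρ (x i)) + (T * (L * w) + k)) (by
      rintro σ _ ⟨ρ, hρ, rfl⟩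
      obtain ⟨q, hq, hρq⟩ := hSnet ρ hρ
      have hdist : dist ρ q ≤ w := by
        rcases hρq with rfl | h
        · simpa using hw.le
        · exact not_lt.1 h
      have h1 := hdisp.sum_abs_sub_le (fun i p hp => hf p hp (x i)) hw.le hρ (hSC hq) hdist
      have h2 := signedSum_le_sum_abs σ fun i => f ρ (x i) - f q (x i)
      rw [signedSum_sub] at h2
      have h3 := Finset.le_sup' (fun ρ => signedSum σ fun i => f ρ (x i)) hq
      linarith)
  rw [signAverage_add, signAverage_const] at hmain
  refine hmain.trans ?_
  have hs : Real.sqrt T * Real.sqrt (2 * (d * (a * ℓ))) =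
      T * (Real.sqrt (2 * a) * Real.sqrt ((d : ℝ) / T * ℓ)) := by
    rw [← Real.sqrt_mul (by positivity), ← Real.sqrt_mul (by positivity)]
    nth_rw 2 [← Real.sqrt_sq hT'.le]
    rw [← Real.sqrt_mul (by positivity)]
    congr 1
    field_simp
  rw [hs] at hmassart
  calc 1 / (T : ℝ) * (signAverage (fun σ => S.sup' hSne fun ρ => signedSum σ fun i => f ρ (x i)) +
        (T * (L * w) + k))
      ≤ 1 / (T : ℝ) * (T * (Real.sqrt (2 * a) * Real.sqrt ((d : ℝ) / T * ℓ)) +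
        (T * (L * w) + k)) := by gcongr
    _ = Real.sqrt (2 * a) * Real.sqrt ((d : ℝ) / T * ℓ) + (L * w + k / T) := by field_simp
    _ ≤ (Real.sqrt (2 * a) + 1) * (Real.sqrt ((d : ℝ) / T * ℓ) + L * w + k / T) := by
      have h1 : 0 ≤ Real.sqrt (2 * a) * (L * w + k / T) := by positivity
      have h2 : 0 ≤ Real.sqrt ((d : ℝ) / T * ℓ) := by positivity
      linarith

/-! ### Sauer–Shelah counting -/

lemma PShatters.card_le {X : Type*} {F : Set (X → ℝ)} {D : ℕ} (hD : pseudoDim F = D)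
    {A : Finset X} (hA : PShatters F A) : A.card ≤ D := by
  have h : (A.card : ℕ∞) ≤ pseudoDim F :=
    le_iSup₂ (f := fun (S : Finset X) (_ : PShatters F S) => (S.card : ℕ∞)) A hA
  rw [hD] at h
  exact_mod_cast h

/-- A form of the Sauer–Shelah lemma for the pseudo-dimension. -/
lemma card_le_sum_choose_of_injOn_patterns {X : Type*} {F : Set (X → ℝ)} {D m : ℕ}
    (hD : ∀ A : Finset X, PShatters F A → A.card ≤ D) (S : Finset (X → ℝ))
    (hS : (S : Set (X → ℝ)) ⊆ F) (y : Fin m → X) (t : Fin m → ℝ)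
    (hinj : ∀ f ∈ S, ∀ g ∈ S, f ≠ g → ∃ j, ¬ (t j ≤ f (y j) ↔ t j ≤ g (y j))) :
    S.card ≤ ∑ i ∈ Finset.range (D + 1), m.choose i := by
  classical
  let pat : (X → ℝ) → Finset (Fin m) := fun f => Finset.univ.filter fun j => t j ≤ f (y j)
  have hpat : ∀ f j, j ∈ pat f ↔ t j ≤ f (y j) := fun f j => by simp [pat]
  have hcard : (S.image pat).card = S.card := by
    refine Finset.card_image_of_injOn fun f hf g hg hfg => ?_
    by_contra hne
    obtain ⟨j, hj⟩ := hinj f hf g hg hne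
    exact hj (by rw [← hpat f j, ← hpat g j, show pat f = pat g from hfg])
  have hvc : (S.image pat).vcDim ≤ D := by
    refine Finset.sup_le fun B hB => ?_
    rw [Finset.mem_shatterer] at hB
    -- Two thresholds at one point are nested conditions, so the two indices cannot both be isolated
    -- by patterns.
    have hyB : Set.InjOn y B := by
      intro i hi j hj hij
      by_contra hne
      have aux : ∀ i ∈ B, ∀ j ∈ B, i ≠ j → ∃ f : X → ℝ, t i ≤ f (y i) ∧ f (y j) < t j := by
        intro i hi j hj hne
        obtain ⟨u, hu, hBu⟩ := hB (Finset.singleton_subset_iff.2 hi)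
        obtain ⟨f, -, rfl⟩ := Finset.mem_image.1 hu
        refine ⟨f, ?_, ?_⟩
        · rw [← hpat]
          have : i ∈ B ∩ pat f := by rw [hBu]; simp
          exact (Finset.mem_inter.1 this).2
        · rw [← not_le, ← hpat]
          intro hjf
          have : j ∈ B ∩ pat f := Finset.mem_inter.2 ⟨hj, hjf⟩
          rw [hBu, Finset.mem_singleton] at this
          exact hne this.symm
      obtain ⟨f, hf1, hf2⟩ := aux i hi j hj hne
      obtain ⟨g, hg1, hg2⟩ := aux j hj i hi (Ne.symm hne)
      rw [hij] at hf1 hg2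
      linarith
    rw [← Finset.card_image_of_injOn hyB]
    refine hD _ ?_
    rcases B.eq_empty_or_nonempty with rfl | ⟨j₀, hj₀⟩
    · obtain ⟨u, hu, -⟩ := hB (Finset.Subset.refl _)
      obtain ⟨f, hf, -⟩ := Finset.mem_image.1 hu
      exact ⟨fun _ => 0, fun E _ => ⟨f, hS hf, by simp⟩⟩
    · have : Nonempty (Fin m) := ⟨j₀⟩
      refine ⟨fun z => t (Function.invFunOn y B z), fun E hE => ?_⟩
      obtain ⟨u, hu, hBu⟩ := hB (Finset.filter_subset (fun j => y j ∈ E) B)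
      obtain ⟨f, hf, rfl⟩ := Finset.mem_image.1 hu
      refine ⟨f, hS hf, fun z hz => ?_⟩
      obtain ⟨j, hj, rfl⟩ := Finset.mem_image.1 hz
      have hinv : Function.invFunOn y B (y j) = j := hyB.leftInvOn_invFunOn hj
      have hiff : t j ≤ f (y j) ↔ y j ∈ E := by
        rw [← hpat]
        have := Finset.ext_iff.1 hBu j
        simpa [Finset.mem_inter, Finset.mem_filter, Finset.mem_coe.1 hj] using this
      simp only [hinv]
      exact ⟨hiff.2, fun h => not_le.1 (mt hiff.1 h)⟩
  calc S.card = (S.image pat).card := hcard.symm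
    _ ≤ (S.image pat).shatterer.card := Finset.card_le_card_shatterer _
    _ ≤ ∑ i ∈ Finset.Iic (S.image pat).vcDim, (Fintype.card (Fin m)).choose i :=
        Finset.card_shatterer_le_sum_vcDim
    _ ≤ ∑ i ∈ Finset.range (D + 1), m.choose i := by
        rw [Fintype.card_fin]
        refine Finset.sum_le_sum_of_subset fun i hi => ?_
        rw [Finset.mem_Iic] at hi
        rw [Finset.mem_range]
        omega

/-- Since `τ ^ D ≤ τ ^ i` for `i ≤ D`, the sum times `τ ^ D` is at most `(1 + τ) ^ m ≤ exp (τ m)`.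
The free `τ` makes the coefficient of `m` as small as needed later. -/
lemma sum_choose_le_exp (D m : ℕ) {τ : ℝ} (hτ0 : 0 < τ) (hτ1 : τ ≤ 1) :
    (∑ i ∈ Finset.range (D + 1), (m.choose i : ℝ)) ≤
      Real.exp (D * Real.log (1 / τ) + τ * m) := by
  have h1 : ∑ i ∈ Finset.range (D + 1), (m.choose i : ℝ) * τ ^ i ≤ (1 + τ) ^ m := by
    rw [add_comm 1 τ, add_pow]
    simp only [one_pow, mul_one]
    calc ∑ i ∈ Finset.range (D + 1), (m.choose i : ℝ) * τ ^ i
        ≤ ∑ i ∈ Finset.range (D + 1 + (m + 1)), (m.choose i : ℝ) * τ ^ i :=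
          Finset.sum_le_sum_of_subset_of_nonneg
            (Finset.range_subset_range.2 (by omega)) fun _ _ _ => by positivity
      _ = ∑ i ∈ Finset.range (m + 1), (m.choose i : ℝ) * τ ^ i := by
          symm
          refine Finset.sum_subset (Finset.range_subset_range.2 (by omega)) fun i _ hi => ?_
          rw [Finset.mem_range, not_lt] at hi
          rw [Nat.choose_eq_zero_of_lt (by omega)]
          simp
      _ = ∑ i ∈ Finset.range (m + 1), τ ^ i * (m.choose i : ℝ) :=
          Finset.sum_congr rfl fun _ _ => mul_comm _ _
  have h2 : (∑ i ∈ Finset.range (D + 1), (m.choose i : ℝ)) * τ ^ D ≤ (1 + τ) ^ m := by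
    refine le_trans ?_ h1
    rw [Finset.sum_mul]
    refine Finset.sum_le_sum fun i hi => ?_
    rw [Finset.mem_range] at hi
    exact mul_le_mul_of_nonneg_left (pow_le_pow_of_le_one hτ0.le hτ1 (by omega)) (by positivity)
  have h3 : (1 + τ) ^ m ≤ Real.exp (τ * m) := by
    rw [mul_comm, Real.exp_nat_mul]
    gcongr
    rw [add_comm]
    exact Real.add_one_le_exp τ
  have h4 : Real.exp (D * Real.log (1 / τ)) = (τ ^ D)⁻¹ := by
    rw [Real.exp_nat_mul, Real.exp_log (by positivity), one_div, inv_pow]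
  rw [Real.exp_add, h4, ← div_eq_inv_mul, le_div_iff₀ (by positivity)]
  exact h2.trans h3

/-! ### Random thresholds and packing numbers -/

/-- If every pair of distinct elements of `S` is separated by a large proportion of `Ω`, then some
short tuple of points of `Ω` separates all pairs. -/
lemma exists_separating_tuple {α Ω : Type*} [Fintype Ω] [Nonempty Ω] (S : Finset α)
    (sep : α → α → Ω → Prop) [∀ a b, DecidablePred (sep a b)] {q : ℝ} {m : ℕ}
    (hq : ∀ a ∈ S, ∀ b ∈ S, a ≠ b →
      ((Finset.univ.filter fun ω => ¬ sep a b ω).card : ℝ) ≤ q * Fintype.card Ω)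
    (hq0 : 0 ≤ q) (hm : (S.card : ℝ) ^ 2 * q ^ m < 1) :
    ∃ ω : Fin m → Ω, ∀ a ∈ S, ∀ b ∈ S, a ≠ b → ∃ j, sep a b (ω j) := by
  classical
  by_contra! hcon
  let bad : α × α → Finset (Fin m → Ω) := fun p =>
    Fintype.piFinset fun _ => Finset.univ.filter fun ω => ¬ sep p.1 p.2 ω
  have hcover : (Finset.univ : Finset (Fin m → Ω)) ⊆ S.offDiag.biUnion bad := by
    intro ω _
    obtain ⟨a, ha, b, hb, hab, h⟩ := hcon ω
    exact Finset.mem_biUnion.2 ⟨(a, b), Finset.mem_offDiag.2 ⟨ha, hb, hab⟩, by simpa [bad] using h⟩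
  have hΩ : (0 : ℝ) < Fintype.card Ω := by exact_mod_cast Fintype.card_pos
  -- Union bound in counting form: if every tuple missed some pair, the bad sets would cover all
  -- tuples.
  have h1 : ((Fintype.card Ω : ℝ)) ^ m ≤ (S.card : ℝ) ^ 2 * (q * Fintype.card Ω) ^ m := by
    calc ((Fintype.card Ω : ℝ)) ^ m = ((Finset.univ : Finset (Fin m → Ω)).card : ℝ) := by simp
      _ ≤ ((S.offDiag.biUnion bad).card : ℝ) := by exact_mod_cast Finset.card_le_card hcover
      _ ≤ ∑ p ∈ S.offDiag, ((bad p).card : ℝ) := by exact_mod_cast Finset.card_biUnion_le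
      _ ≤ ∑ _p ∈ S.offDiag, (q * Fintype.card Ω) ^ m := by
          refine Finset.sum_le_sum fun p hp => ?_
          rw [Finset.mem_offDiag] at hp
          simp only [bad, Fintype.card_piFinset_const, Nat.cast_pow]
          gcongr
          exact hq _ hp.1 _ hp.2.1 hp.2.2
      _ ≤ (S.card : ℝ) ^ 2 * (q * Fintype.card Ω) ^ m := by
          rw [Finset.sum_const, nsmul_eq_mul]
          gcongr
          rw [Finset.offDiag_card, sq]
          exact_mod_cast Nat.sub_le _ _
  rw [mul_pow, ← mul_assoc] at h1
  have := mul_lt_mul_of_pos_right hm (pow_pos hΩ m)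
  linarith

/-- The number of grid thresholds in `(0, 1]` separating `a` and `b`. -/
lemma card_separating_thresholds_ge {M : ℕ} (hM : 0 < M) {a b : ℝ} (ha : a ∈ Set.Icc (0 : ℝ) 1)
    (hb : b ∈ Set.Icc (0 : ℝ) 1) :
    M * |a - b| - 1 ≤ ((Finset.univ.filter fun t : Fin M =>
      ¬ (((t : ℝ) + 1) / M ≤ a ↔ ((t : ℝ) + 1) / M ≤ b)).card : ℝ) := by
  wlog hab : a ≤ b generalizing a b
  · have := this hb ha (le_of_not_ge hab)
    rw [abs_sub_comm]
    simpa only [iff_comm] using this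
  have hM' : (0 : ℝ) < M := by exact_mod_cast hM
  -- The threshold `(t + 1) / M` is at most `a` exactly when `t < ⌊a * M⌋₊`; rounding costs the 1 in
  -- the bound.
  have hsub : Finset.Ico ⌊a * M⌋₊ ⌊b * M⌋₊ ⊆ (Finset.univ.filter fun t : Fin M =>
      ¬ (((t : ℝ) + 1) / M ≤ a ↔ ((t : ℝ) + 1) / M ≤ b)).map Fin.valEmbedding := by
    intro n hn
    rw [Finset.mem_Ico] at hn
    have hb0 : 0 ≤ b * M := mul_nonneg hb.1 hM'.le
    have hn1 : a * M < n + 1 := (Nat.floor_lt' (by omega)).1 (Nat.lt_succ_of_le hn.1) |>.trans_eq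
      (by push_cast; ring)
    have hn2 : (n : ℝ) + 1 ≤ b * M := by
      have : ((n + 1 : ℕ) : ℝ) ≤ b * M := (Nat.le_floor_iff hb0).1 hn.2
      exact_mod_cast this
    have hnM : n < M := by
      have : (n : ℝ) + 1 ≤ M := hn2.trans (mul_le_of_le_one_left hM'.le hb.2)
      exact_mod_cast this
    refine Finset.mem_map.2 ⟨⟨n, hnM⟩, ?_, rfl⟩
    rw [Finset.mem_filter]
    refine ⟨Finset.mem_univ _, fun h => ?_⟩
    have := h.2 ((div_le_iff₀ hM').2 hn2)
    rw [div_le_iff₀ hM'] at this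
    exact absurd this (not_le.2 hn1)
  have hcard := Finset.card_le_card hsub
  rw [Finset.card_map, Nat.card_Ico] at hcard
  have h1 : ⌊b * M⌋₊ ≤ (Finset.univ.filter fun t : Fin M =>
      ¬ (((t : ℝ) + 1) / M ≤ a ↔ ((t : ℝ) + 1) / M ≤ b)).card + ⌊a * M⌋₊ := by omega
  have h2 : (⌊b * M⌋₊ : ℝ) ≤ ((Finset.univ.filter fun t : Fin M =>
      ¬ (((t : ℝ) + 1) / M ≤ a ↔ ((t : ℝ) + 1) / M ≤ b)).card : ℝ) + ⌊a * M⌋₊ := by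
    exact_mod_cast h1
  have h3 := Nat.floor_le (mul_nonneg ha.1 hM'.le)
  have h4 := Nat.lt_floor_add_one (b * M)
  rw [abs_sub_comm, abs_of_nonneg (sub_nonneg.2 hab)]
  linarith

/-- The packing numbers of a class of pseudo-dimension `D`, in the empirical `L¹` distance. -/
lemma log_card_le_of_separated {X : Type*} {T D : ℕ} (hT : 0 < T) (hD1 : 1 ≤ D)
    {F : Set (X → ℝ)} (hD : ∀ A : Finset X, PShatters F A → A.card ≤ D)
    (hF : ∀ f ∈ F, ∀ y, f y ∈ Set.Icc (0 : ℝ) 1) (x : Fin T → X) {ε : ℝ} (hε0 : 0 < ε)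
    (hε1 : ε ≤ 1) (S : Finset (X → ℝ)) (hS : (S : Set (X → ℝ)) ⊆ F)
    (hsep : (S : Set (X → ℝ)).Pairwise fun f g => T * ε ≤ ∑ i, |f (x i) - g (x i)|) :
    Real.log S.card ≤ 3 * D * Real.log (8 / ε) := by
  classical
  have hlog1 : 1 ≤ Real.log (8 / ε) := by
    rw [Real.le_log_iff_exp_le (by positivity)]
    have h8 : (8 : ℝ) ≤ 8 / ε := (le_div_iff₀ hε0).2 (by linarith)
    linarith [Real.exp_one_lt_d9]
  have hD1' : (1 : ℝ) ≤ D := by exact_mod_cast hD1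
  rcases S.eq_empty_or_nonempty with rfl | hSne
  · simp only [Finset.card_empty, Nat.cast_zero, Real.log_zero]
    positivity
  have hN : (1 : ℝ) ≤ S.card := by exact_mod_cast hSne.card_pos
  have hlogN : 0 ≤ Real.log S.card := Real.log_nonneg hN
  -- Fine enough that the rounding loss of 1 per sample point is at most half of `M ε`.
  set M := ⌈2 / ε⌉₊ with hMdef
  have hM : 0 < M := Nat.ceil_pos.2 (by positivity)
  have hM' : (0 : ℝ) < M := by exact_mod_cast hM
  have hMε : 2 ≤ M * ε := (div_le_iff₀ hε0).1 (Nat.le_ceil _)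
  have hT' : (0 : ℝ) < T := by exact_mod_cast hT
  have : Nonempty (Fin T × Fin M) := ⟨(⟨0, hT⟩, ⟨0, hM⟩)⟩
  -- Strictly above `4 log N / ε`, so that `N² (1 - ε/2)^m < 1`.
  set m := ⌊4 * Real.log S.card / ε⌋₊ + 1 with hmdef
  have hm1 : 4 * Real.log S.card / ε < m := by
    rw [hmdef]; push_cast; exact Nat.lt_floor_add_one _
  have hm2 : (m : ℝ) ≤ 4 * Real.log S.card / ε + 1 := by
    rw [hmdef]; push_cast
    have := Nat.floor_le (show 0 ≤ 4 * Real.log S.card / ε by positivity)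
    linarith
  obtain ⟨ω, hω⟩ := exists_separating_tuple (Ω := Fin T × Fin M) S
    (fun f g p => ¬ (((p.2 : ℝ) + 1) / M ≤ f (x p.1) ↔ ((p.2 : ℝ) + 1) / M ≤ g (x p.1)))
    (q := 1 - ε / 2) (m := m) (by
      intro f hf g hg hfg
      have htot := Finset.card_filter_add_card_filter_not (s := (Finset.univ : Finset (Fin T × Fin M)))
        (fun p => ¬ (((p.2 : ℝ) + 1) / M ≤ f (x p.1) ↔ ((p.2 : ℝ) + 1) / M ≤ g (x p.1)))
      have hge : (T : ℝ) * M * (ε / 2) ≤ ((Finset.univ.filter fun p : Fin T × Fin M =>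
          ¬ (((p.2 : ℝ) + 1) / M ≤ f (x p.1) ↔ ((p.2 : ℝ) + 1) / M ≤ g (x p.1))).card : ℝ) := by
        have hsum : (Finset.univ.filter fun p : Fin T × Fin M =>
            ¬ (((p.2 : ℝ) + 1) / M ≤ f (x p.1) ↔ ((p.2 : ℝ) + 1) / M ≤ g (x p.1))).card =
            ∑ i : Fin T, (Finset.univ.filter fun t : Fin M =>
              ¬ (((t : ℝ) + 1) / M ≤ f (x i) ↔ ((t : ℝ) + 1) / M ≤ g (x i))).card := by
          simp only [Finset.card_filter]
          rw [Fintype.sum_prod_type]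
        rw [hsum]
        push_cast
        calc (T : ℝ) * M * (ε / 2) ≤ M * ∑ i, |f (x i) - g (x i)| - T := by
              have h1 := mul_le_mul_of_nonneg_left (hsep hf hg hfg) hM'.le
              have h2 := mul_le_mul_of_nonneg_left hMε hT'.le
              linarith
          _ = ∑ i, (M * |f (x i) - g (x i)| - 1) := by
              simp [Finset.sum_sub_distrib, Finset.mul_sum]
          _ ≤ _ := Finset.sum_le_sum fun i _ => card_separating_thresholds_ge hM
              (hF f (hS hf) _) (hF g (hS hg) _)
      have htot' := congrArg (Nat.cast (R := ℝ)) htot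
      simp only [Nat.cast_add, Finset.card_univ, Fintype.card_prod, Fintype.card_fin,
        Nat.cast_mul] at htot' ⊢
      linarith) (by linarith) (by
      have h1 : (1 - ε / 2) ^ m ≤ Real.exp (-(m * (ε / 2))) := by
        rw [← mul_neg, Real.exp_nat_mul]
        exact pow_le_pow_left₀ (by linarith) (by linarith [Real.add_one_le_exp (-(ε / 2))]) _
      have h2 : (S.card : ℝ) ^ 2 = Real.exp (2 * Real.log S.card) := by
        rw [mul_comm, Real.exp_mul, Real.exp_log (by linarith)]
        norm_cast
      calc (S.card : ℝ) ^ 2 * (1 - ε / 2) ^ m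
          ≤ Real.exp (2 * Real.log S.card) * Real.exp (-(m * (ε / 2))) := by
            rw [h2]; gcongr
        _ = Real.exp (2 * Real.log S.card - m * (ε / 2)) := by rw [← Real.exp_add]; rfl
        _ < 1 := by
            rw [Real.exp_lt_one_iff]
            rw [div_lt_iff₀ hε0] at hm1
            linarith)
  have hsauer := card_le_sum_choose_of_injOn_patterns hD S hS (fun j => x (ω j).1)
    (fun j => ((((ω j).2 : ℕ) : ℝ) + 1) / M) hω
  -- With `τ = ε / 8` the term `τ m` is at most `log N / 2 + 1/8`, so half of `log N` can be moved
  -- to the left.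
  have hchoose := sum_choose_le_exp D m (τ := ε / 8) (by positivity) (by linarith)
  have hlog := (Real.log_le_iff_le_exp (show (0 : ℝ) < S.card by linarith)).2
    (le_trans (by exact_mod_cast hsauer) hchoose)
  rw [one_div_div] at hlog
  have hτm : ε / 8 * m ≤ Real.log S.card / 2 + 1 / 8 := by
    calc ε / 8 * m ≤ ε / 8 * (4 * Real.log S.card / ε + 1) := by gcongr
      _ = Real.log S.card / 2 + ε / 8 := by field_simp; ring
      _ ≤ _ := by linarith
  have : 1 ≤ D * Real.log (8 / ε) := one_le_mul_of_one_le_of_one_le hD1' hlog1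
  linarith

/-! ### Chaining over `L²` nets -/

/-- Nets of a class of pseudo-dimension `D`, in the empirical `L²` distance. -/
lemma exists_l2_net {X : Type*} {T D : ℕ} (hT : 0 < T) (hD1 : 1 ≤ D)
    {F : Set (X → ℝ)} (hD : ∀ A : Finset X, PShatters F A → A.card ≤ D)
    (hF : ∀ f ∈ F, ∀ y, f y ∈ Set.Icc (0 : ℝ) 1) (x : Fin T → X) (j : ℕ) :
    ∃ S : Finset (X → ℝ), (S : Set (X → ℝ)) ⊆ F ∧ Real.log S.card ≤ 9 * D * (j + 1) ∧
      ∀ f ∈ F, ∃ g ∈ S, ∑ i, (f (x i) - g (x i)) ^ 2 ≤ T * ((1 / 2 : ℝ) ^ j) ^ 2 := by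
  have hT' : (0 : ℝ) < T := by exact_mod_cast hT
  let far : (X → ℝ) → (X → ℝ) → Prop := fun f g =>
    T * ((1 / 2 : ℝ) ^ j) ^ 2 < ∑ i, (f (x i) - g (x i)) ^ 2
  have hlog8 : Real.log (8 / ((1 / 2 : ℝ) ^ j) ^ 2) ≤ 3 * (j + 1) := by
    have h : (8 : ℝ) / ((1 / 2 : ℝ) ^ j) ^ 2 = 2 ^ (3 + 2 * j) := by
      rw [← pow_mul, mul_comm j 2, one_div, inv_pow, div_inv_eq_mul, pow_add]
      norm_num
    rw [h, Real.log_pow]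
    have h2 : Real.log 2 ≤ 1 := Real.log_two_lt_d9.le.trans (by norm_num)
    calc ((3 + 2 * j : ℕ) : ℝ) * Real.log 2 ≤ ((3 + 2 * j : ℕ) : ℝ) * 1 := by gcongr
      _ ≤ 3 * (j + 1) := by
        push_cast
        have : (0 : ℝ) ≤ j := by positivity
        linarith
  have hlog : ∀ S : Finset (X → ℝ), (S : Set (X → ℝ)) ⊆ F → (S : Set (X → ℝ)).Pairwise far →
      Real.log S.card ≤ 9 * D * (j + 1) := by
    intro S hS hsep
    refine (log_card_le_of_separated hT hD1 hD hF x (ε := ((1 / 2 : ℝ) ^ j) ^ 2) (by positivity)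
      (pow_le_one₀ (by positivity) (pow_le_one₀ (by norm_num) (by norm_num))) S hS ?_).trans ?_
    · intro f hf g hg hfg
      -- Differences are at most 1 in absolute value, so `L²` separation at scale `2^(-j)` gives
      -- `L¹` separation at scale `4^(-j)`.
      refine (hsep hf hg hfg).le.trans (Finset.sum_le_sum fun i _ => ?_)
      have h1 := hF f (hS hf) (x i)
      have h2 := hF g (hS hg) (x i)
      rw [← sq_abs, sq]
      refine mul_le_of_le_one_left (abs_nonneg _) (abs_le.2 ⟨?_, ?_⟩)
      · linarith [h1.1, h2.2]
      · linarith [h1.2, h2.1]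
    · calc 3 * (D : ℝ) * Real.log (8 / ((1 / 2 : ℝ) ^ j) ^ 2) ≤ 3 * D * (3 * (j + 1)) := by gcongr
        _ = 9 * D * (j + 1) := by ring
  obtain ⟨S, hS, hsep, hnet⟩ := exists_net far
    (fun f g h => by
      simp only [far] at h ⊢
      simpa only [← neg_sub (f _), neg_sq] using h)
    F ⌊Real.exp (9 * D * (j + 1))⌋₊ (fun S h1 h2 => Nat.le_floor (by
      rcases Nat.eq_zero_or_pos S.card with h | h
      · rw [h, Nat.cast_zero]; positivity
      · exact (Real.log_le_iff_le_exp (by exact_mod_cast h)).1 (hlog S h1 h2)))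
  refine ⟨S, hS, hlog S hS hsep, fun f hf => ?_⟩
  obtain ⟨g, hg, hfg⟩ := hnet f hf
  refine ⟨g, hg, ?_⟩
  rcases hfg with rfl | h
  · simp only [sub_self]
    rw [Finset.sum_eq_zero fun _ _ => by norm_num]
    positivity
  · exact not_lt.1 h

/-- The chaining bound for classes of finite pseudo-dimension. -/
lemma empiricalRademacher_le_of_pseudoDim {X : Type*} {T D : ℕ} (hT : 0 < T)
    {F : Set (X → ℝ)} (hFne : F.Nonempty) (hD : pseudoDim F = D)
    (hF : ∀ f ∈ F, ∀ y, f y ∈ Set.Icc (0 : ℝ) 1) (x : Fin T → X) :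
    empiricalRademacher F x ≤ 51 * Real.sqrt ((D : ℝ) / T) := by
  rcases Nat.eq_zero_or_pos D with rfl | hD1
  · have hsub : F.Subsingleton := by
      intro f hf g hg
      by_contra hne
      obtain ⟨y, hy⟩ := Function.ne_iff.1 hne
      have aux : ∀ f ∈ F, ∀ g ∈ F, ¬ f y < g y := by
        intro f hf g hg hlt
        have hsh : PShatters F {y} := by
          refine ⟨g, fun E _ => ?_⟩
          by_cases hyE : y ∈ E
          · exact ⟨g, hg, by simp [hyE]⟩
          · exact ⟨f, hf, by simp [hyE, hlt]⟩
        have := hsh.card_le hD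
        simp at this
      exact hy (le_antisymm (not_lt.1 (aux g hg f hf)) (not_lt.1 (aux f hf g hg)))
    refine (empiricalRademacher_nonpos_of_subsingleton hFne hsub x).trans (by positivity)
  have hT' : (0 : ℝ) < T := by exact_mod_cast hT
  have hD' : (0 : ℝ) < D := by exact_mod_cast hD1
  choose S hSF hScard hSnet using exists_l2_net hT hD1 (fun A hA => hA.card_le hD) hF x
  have hSne : ∀ j, (S j).Nonempty := by
    intro j
    obtain ⟨f, hf⟩ := hFne
    obtain ⟨g, hg, -⟩ := hSnet j f hf
    exact ⟨g, hg⟩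
  set A := Real.sqrt T * Real.sqrt (18 * D) with hA
  -- The closed form telescopes: going from `j` to `j + 1` adds `A (j + 2) 2^(-j)`, and the total
  -- stays below `10 A`.
  have hchain : ∀ j : ℕ, signAverage (fun σ => (S j).sup' (hSne j) fun g =>
      signedSum σ fun i => g (x i)) ≤ A * (10 - (2 * j + 6) * (1 / 2 : ℝ) ^ j) := by
    intro j
    induction j with
    | zero =>
      refine (signAverage_sup_le (S 0) (hSne 0) (fun g i => g (x i)) (r := Real.sqrt T)
        (B := 9 * D) (by positivity) (by positivity) ?_ (by simpa using hScard 0)).trans ?_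
      · intro g hg
        rw [Real.sq_sqrt hT'.le]
        calc ∑ i, g (x i) ^ 2 ≤ ∑ _i : Fin T, (1 : ℝ) := by
              refine Finset.sum_le_sum fun i _ => ?_
              have := hF g (hSF 0 hg) (x i)
              exact pow_le_one₀ this.1 this.2
          _ = T := by simp
      · have h : 2 * (9 * (D : ℝ)) = 18 * D := by ring
        rw [h, ← hA]
        have : 0 ≤ A := by positivity
        norm_num
        linarith
    | succ j ih =>
      -- Each `g` has one parent `p g` in the coarser net, so the increments are indexed by `S (j +
      -- 1)` alone.
      choose! p hpS hp using fun f (hf : f ∈ F) => hSnet j f hf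
      have hinc := signAverage_sup_le (S (j + 1)) (hSne (j + 1))
        (fun g i => g (x i) - p g (x i)) (r := Real.sqrt T * (1 / 2 : ℝ) ^ j)
        (B := 9 * D * (j + 2)) (by positivity) (by positivity)
        (fun g hg => by
          rw [mul_pow, Real.sq_sqrt hT'.le]
          exact hp g (hSF _ hg))
        (by
          have := hScard (j + 1)
          push_cast at this
          rwa [show (j : ℝ) + 2 = j + 1 + 1 by ring])
      have hsplit : signAverage (fun σ => (S (j + 1)).sup' (hSne (j + 1)) fun g =>
          signedSum σ fun i => g (x i)) ≤
          signAverage (fun σ => (S j).sup' (hSne j) fun g => signedSum σ fun i => g (x i)) +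
          signAverage (fun σ => (S (j + 1)).sup' (hSne (j + 1)) fun g =>
            signedSum σ fun i => g (x i) - p g (x i)) := by
        rw [← signAverage_add]
        refine signAverage_mono fun σ => Finset.sup'_le _ _ fun g hg => ?_
        have h1 := Finset.le_sup' (fun g => signedSum σ fun i => g (x i)) (hpS g (hSF _ hg))
        have h2 := Finset.le_sup' (fun g => signedSum σ fun i => g (x i) - p g (x i)) hg
        simp only [signedSum_sub] at h2 ⊢
        linarith
      have hsqrt : Real.sqrt (2 * (9 * D * (j + 2))) ≤ Real.sqrt (18 * D) * (j + 2) := by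
        rw [show 2 * (9 * (D : ℝ) * (j + 2)) = 18 * D * (j + 2) by ring,
          Real.sqrt_mul (by positivity)]
        gcongr
        rw [Real.sqrt_le_left (by positivity)]
        have : (0 : ℝ) ≤ j := by positivity
        nlinarith
      calc _ ≤ A * (10 - (2 * j + 6) * (1 / 2 : ℝ) ^ j) +
            Real.sqrt T * (1 / 2 : ℝ) ^ j * (Real.sqrt (18 * D) * (j + 2)) :=
            hsplit.trans (add_le_add ih (hinc.trans (by gcongr)))
        _ = A * (10 - (2 * ((j + 1 : ℕ) : ℝ) + 6) * (1 / 2 : ℝ) ^ (j + 1)) := by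
            rw [hA]; push_cast; ring
  -- Chaining stops once the approximation error falls below the target. With `√18 ≤ 5` this yields
  -- `51 = 5 * 10 + 1`.
  obtain ⟨J, hJ⟩ := exists_pow_lt_of_lt_one (show 0 < Real.sqrt ((D : ℝ) / T) by positivity)
    (show (1 / 2 : ℝ) < 1 by norm_num)
  have hmain := empiricalRademacher_le_signAverage hFne x
    (fun σ => ((S J).sup' (hSne J) fun g => signedSum σ fun i => g (x i)) + T * (1 / 2 : ℝ) ^ J) (by
      intro σ f hf
      obtain ⟨g, hg, hfg⟩ := hSnet J f hf
      have h1 := signedSum_le_sum_abs σ fun i => f (x i) - g (x i)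
      have h2 := Finset.le_sup' (fun g => signedSum σ fun i => g (x i)) hg
      -- Cauchy–Schwarz, from `L²` to `L¹`.
      have h3 : ∑ i, |f (x i) - g (x i)| ≤ T * (1 / 2 : ℝ) ^ J := by
        refine abs_le_of_sq_le_sq' ?_ (by positivity) |>.2
        have := sq_sum_le_card_mul_sum_sq (s := Finset.univ) (f := fun i => |f (x i) - g (x i)|)
        simp only [sq_abs, Finset.card_univ, Fintype.card_fin] at this
        calc _ ≤ (T : ℝ) * ∑ i, (f (x i) - g (x i)) ^ 2 := this
          _ ≤ T * (T * ((1 / 2 : ℝ) ^ J) ^ 2) := by gcongr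
          _ = _ := by ring
      rw [signedSum_sub] at h1
      linarith)
  rw [signAverage_add, signAverage_const] at hmain
  have hs : A ≤ T * (5 * Real.sqrt ((D : ℝ) / T)) := by
    have h18 : Real.sqrt 18 ≤ 5 := by
      rw [Real.sqrt_le_left (by norm_num)]; norm_num
    have : A = T * (Real.sqrt 18 * Real.sqrt ((D : ℝ) / T)) := by
      rw [hA, Real.sqrt_mul (by norm_num), Real.sqrt_div hD'.le]
      nth_rw 2 [← Real.mul_self_sqrt hT'.le]
      field_simp
    rw [this]
    gcongr
  have hA0 : 0 ≤ A := by positivity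
  have hJ0 : 0 ≤ A * ((2 * J + 6) * (1 / 2 : ℝ) ^ J) := by positivity
  refine hmain.trans ?_
  calc _ ≤ 1 / (T : ℝ) * (T * (5 * Real.sqrt ((D : ℝ) / T)) * 10 +
        T * Real.sqrt ((D : ℝ) / T)) := by
        gcongr
        refine (hchain J).trans ?_
        linarith
    _ = 51 * Real.sqrt ((D : ℝ) / T) := by field_simp; ring

theorem mainTheorem12 (c : ℝ) (hc : 1 < c) :
    ∃ K : ℝ, 0 < K ∧
      ∀ (X : Type u) (d T : ℕ) (C : Set (EuclideanSpace ℝ (Fin d)))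
        (f : EuclideanSpace ℝ (Fin d) → X → ℝ) (x : Fin T → X)
        (ρ₀ : EuclideanSpace ℝ (Fin d)) (R w : ℝ) (L : ℝ≥0) (k : ℕ),
        0 < T → C.Nonempty →
        (∀ ρ ∈ C, ∀ y : X, f ρ y ∈ Set.Icc (0 : ℝ) 1) →
        C ⊆ Metric.closedBall ρ₀ R →
        0 < w → c * w ≤ R →
        PiecewiseLipschitzDispersed C L w k (fun i ρ => f ρ (x i)) →
        (∀ D : ℕ, pseudoDim (f '' C) = (D : ℕ∞) →
          empiricalRademacher (f '' C) x ≤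
            K * min (Real.sqrt ((d : ℝ) / T * Real.log (R / w)) + (L : ℝ) * w + (k : ℝ) / T)
              (Real.sqrt ((D : ℝ) / T))) ∧
        (pseudoDim (f '' C) = ⊤ →
          empiricalRademacher (f '' C) x ≤
            K * (Real.sqrt ((d : ℝ) / T * Real.log (R / w)) + (L : ℝ) * w + (k : ℝ) / T)) := by
  have hlogc : 0 < Real.log c := Real.log_pos hc
  set K₁ := Real.sqrt (2 * (1 + Real.log 3 / Real.log c)) + 1
  refine ⟨max K₁ 51, lt_max_of_lt_right (by norm_num), ?_⟩
  intro X d T C f x ρ₀ R w L k hT hC hf hCR hw hR hdisp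
  have hcR : 1 ≤ R / w := hc.le.trans ((le_div_iff₀ hw).2 hR)
  have hlog : 0 ≤ Real.log (R / w) := Real.log_nonneg hcR
  have h₁ : empiricalRademacher (f '' C) x ≤ max K₁ 51 *
      (Real.sqrt ((d : ℝ) / T * Real.log (R / w)) + (L : ℝ) * w + (k : ℝ) / T) := by
    refine (empiricalRademacher_le_of_dispersed hc hT hC hf hCR hw hR hdisp).trans ?_
    gcongr
    exact le_max_left _ _
  refine ⟨fun D hD => ?_, fun _ => h₁⟩
  rw [mul_min_of_nonneg _ _ (le_max_of_le_right (by norm_num : (0 : ℝ) ≤ 51))]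
  refine le_min h₁ ?_
  refine (empiricalRademacher_le_of_pseudoDim hT (hC.image f) hD ?_ x).trans ?_
  · rintro _ ⟨ρ, hρ, rfl⟩
    exact hf ρ hρ
  · gcongr
    exact le_max_right _ _
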